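/- Let $p$ be an odd prime, let $\mathbb{K}$ be a number field with algebraic closure $\overline{\mathbb{K}}$, and fix an embedding $\iota\colon\overline{\mathbb{K}}\hookrightarrow\overline{\mathbb{Q}}_p$. Let $v$ be the $p$-adic place of $\mathbb{K}$ determined by $\iota$, let $G_v\subseteq \mathrm{Gal}(\overline{\mathbb{K}}/\mathbb{K})$ be the corresponding decomposition group (the stabilizer of the valuation ring $\{x\in\overline{\mathbb{K}} : |\iota(x)|_p\le 1\}$), and let $I_v\subseteq G_v$ be its inertia subgroup (the elements acting trivially on the residue field of this valuation ring). Let $d\ge 1$ and let $\rho\colon G_v\to\mathrm{GL}_d(\mathbb{Z}_p)$ be a continuous representation. Assume that $\rho(G_v)$ contains an open subgroup of $\mathrm{SL}_d(\mathbb{Z}_p)$. Then: (i) $\rho(I_v)$ contains an open subgroup of $\mathrm{SL}_d(\mathbb{Z}_p)$; (ii) if $\det(\rho(I_v))$ is infinite, then $\rho(I_v)$ is open in $\mathrm{GL}_d(\mathbb{Z}_p)$. -/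

import Mathlib

open scoped NNReal MatrixGroups

noncomputable section

/-- The `p`-adic place of the number field `K` determined by an embedding `ι` of an algebraic
closure `Kbar` of `K` into the algebraic closure `PadicAlgCl p` of `ℚ_[p]`, recorded as the
valuation ring `{x : Kbar | |ι x|_p ≤ 1}` of the place of `Kbar` above it. -/
def embeddingValuationRing (p : ℕ) [Fact p.Prime] {Kbar : Type*} [Field Kbar]
    (ι : Kbar →+* PadicAlgCl p) : ValuationSubring Kbar :=
  (Valued.v : Valuation (PadicAlgCl p) ℝ≥0).valuationSubring.comap ι

/-- The decomposition group `G_v ⊆ G_K = Gal(Kbar/K)` of the place determined by `ι`. It carries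
the subspace topology of the Krull topology on `Gal(Kbar/K)`. -/
abbrev decompositionGroup (p : ℕ) [Fact p.Prime] (K : Type*) [Field K] {Kbar : Type*} [Field Kbar]
    [Algebra K Kbar] (ι : Kbar →+* PadicAlgCl p) : Subgroup (Kbar ≃ₐ[K] Kbar) :=
  (embeddingValuationRing p ι).decompositionSubgroup K

/-- The inertia subgroup `I_v ⊆ G_v`: the elements of the decomposition group that act trivially
on the residue field of the valuation ring. -/
abbrev inertiaGroup (p : ℕ) [Fact p.Prime] (K : Type*) [Field K] {Kbar : Type*} [Field Kbar]
    [Algebra K Kbar] (ι : Kbar →+* PadicAlgCl p) : Subgroup (decompositionGroup p K ι) :=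
  (embeddingValuationRing p ι).inertiaSubgroup K

/-- A subgroup `H` of `GL_d(ℤ_p)` contains an open subgroup of `SL_d(ℤ_p)`. -/
def ContainsOpenSubgroupOfSL (p : ℕ) [Fact p.Prime] (d : ℕ) (H : Subgroup (GL (Fin d) ℤ_[p])) :
    Prop :=
  ∃ U : Subgroup (SL(d, ℤ_[p])), IsOpen (U : Set (SL(d, ℤ_[p]))) ∧
    U.map Matrix.SpecialLinearGroup.toGL ≤ H

end

/-! The residue field of the valuation ring is algebraic over `𝔽_p`, so its nonzero elements are
roots of unity and its automorphisms commute. Hence `G_v / I_v` is abelian, and every commutator of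
`ρ(G_v)` lies in `ρ(I_v)`.

For (i) it remains to see that commutators of a congruence subgroup of `SL_d(ℤ_p)` generate an open
subgroup (`SLCongruenceSubgroup_le_of_commutator_mem`). A commutator of a diagonal matrix with a
transvection is a transvection. For odd `p` these give every transvection with coefficient in `p ^
(2 * k)`, and Gaussian elimination (`ContainsTransvections.mem_of_sq_dvd`) builds the congruence
subgroup of level `4 * k` from them.

For (ii), `ρ(I_v)` is compact, so the determinants of its elements close to `1` form a closed
subgroup of `ℤ_p^×`. If `det` has infinite image, this subgroup is nontrivial and therefore contains
a neighbourhood of `1`. Together with (i) this makes `ρ(I_v)` open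
(`ContainsOpenSubgroupOfSL.isOpen_of_infinite_det`). -/

open scoped NNReal MatrixGroups commutatorElement
open Matrix

/-! ### Gaussian elimination with transvections divisible by `q`. -/

section CongruenceElimination

variable {n R : Type*} [Fintype n] [DecidableEq n] [CommRing R]

/-- The submonoid `T` of matrices contains the transvections with coefficients divisible by `q`. -/
def ContainsTransvections (q : R) (T : Submonoid (Matrix n n R)) : Prop :=
  ∀ i j, i ≠ j → ∀ x, Matrix.transvection i j (q * x) ∈ T

/-- Off-diagonal matrix units in one column `k` multiply to zero, so the product of their
transvections just adds the entries. This is the operation that clears a column. -/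
theorem ContainsTransvections.one_add_vecMulVec_mem {q : R} {T : Submonoid (Matrix n n R)}
    (hT : ContainsTransvections q T) (k : n) (v : n → R) (hk : v k = 0) (hv : ∀ i, q ∣ v i) :
    1 + vecMulVec v (Pi.single k 1) ∈ T := by
  have key : ∀ s : Finset n, k ∉ s → 1 + ∑ i ∈ s, Matrix.single i k (v i) ∈ T := by
    intro s
    induction s using Finset.induction_on with
    | empty => intro _; simp
    | insert a s ha ih =>
      intro hs
      rw [Finset.mem_insert, not_or] at hs
      obtain ⟨x, hx⟩ := hv a
      have h := T.mul_mem (hT a k (Ne.symm hs.1) x) (ih hs.2)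
      have h0 : Matrix.single a k (v a) * ∑ i ∈ s, Matrix.single i k (v i) = 0 := by
        rw [Finset.mul_sum]
        exact Finset.sum_eq_zero fun i hi =>
          Matrix.single_mul_single_of_ne _ _ _ _ (fun h => hs.2 (by rwa [h])) _
      rw [← hx, transvection, add_mul, one_mul, mul_add, h0, mul_one, add_zero] at h
      rw [Finset.sum_insert ha]
      convert! h using 1
      abel
  convert! key (Finset.univ.erase k) (Finset.notMem_erase _ _) using 2
  ext i j
  rw [Matrix.sum_apply, vecMulVec_apply]
  by_cases hj : j = k
  · subst hj
    by_cases hi : i = j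
    · subst hi
      rw [hk, zero_mul, Finset.sum_eq_zero]
      intro a ha
      exact Matrix.single_apply_of_row_ne (Finset.ne_of_mem_erase ha) _ _ _
    · rw [Finset.sum_eq_single i]
      · simp
      · intro b _ hb
        exact Matrix.single_apply_of_row_ne hb _ _ _
      · simp [hi]
  · rw [Finset.sum_eq_zero]
    · simp [hj]
    · intro a _
      exact Matrix.single_apply_of_col_ne _ _ (Ne.symm hj) _

/-- Writing `u = 1 + q * (q * x)` exhibits `u` as the corner entry of a product of two transvections
divisible by `q`; two more clear the off-diagonal entries. This is where the square of `q` is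
needed. -/
theorem ContainsTransvections.diagonal_pair_mem {q : R} {T : Submonoid (Matrix n n R)}
    (hT : ContainsTransvections q T) {i j : n} (hij : i ≠ j) (u : Rˣ) (hu : q ^ 2 ∣ (u : R) - 1) :
    Matrix.diagonal (Function.update (Function.update 1 i (u : R)) j (↑u⁻¹ : R)) ∈ T := by
  obtain ⟨x, hx⟩ := hu
  have hu' : (u : R) = 1 + q * (q * x) := by linear_combination hx
  have hinv : (1 + q * (q * x)) * (↑u⁻¹ : R) = 1 := by rw [← hu']; exact u.mul_inv
  have key (M : Matrix n n R) : Matrix.transvection i j (q * -u) *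
      (Matrix.transvection j i (q * -(x * ↑u⁻¹)) * (Matrix.transvection i j (q * 1) *
        (Matrix.transvection j i (q * x) * M))) =
      Matrix.diagonal (Function.update (Function.update 1 i (u : R)) j (↑u⁻¹ : R)) * M := by
    ext r s
    by_cases hri : r = i
    · subst hri
      simp only [transvection_mul_apply_same, transvection_mul_apply_of_ne, ne_eq, hij, hij.symm,
        not_false_eq_true, Matrix.diagonal_mul, Function.update_of_ne, Function.update_self, hu']
      linear_combination (q * q * x * (M r s + q * (M j s + q * x * M r s))) * hinv
    · by_cases hrj : r = j
      · subst hrj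
        simp only [transvection_mul_apply_same, transvection_mul_apply_of_ne, ne_eq, hij, hij.symm,
          not_false_eq_true, Matrix.diagonal_mul, Function.update_self]
        linear_combination (-M r s - q * x * M i s) * hinv
      · simp [hri, hrj, Matrix.diagonal_mul]
  have h := T.mul_mem (hT i j hij (-u)) (T.mul_mem (hT j i hij.symm (-(x * ↑u⁻¹)))
    (T.mul_mem (hT i j hij 1) (T.mul_mem (hT j i hij.symm x) T.one_mem)))
  rwa [key, mul_one] at h

theorem prod_update_update_one {i j : n} (hij : i ≠ j) (a b : R) :
    ∏ k, Function.update (Function.update (1 : n → R) i a) j b k = a * b := by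
  rw [Finset.prod_update_of_mem (Finset.mem_univ _), Finset.prod_update_of_mem (by simp [hij])]
  simp [mul_comm]

theorem isUnit_of_sq_dvd_sub_one [IsLocalRing R] {q : R} (hq : q ∈ IsLocalRing.maximalIdeal R)
    {t : R} (ht : q ^ 2 ∣ t - 1) : IsUnit t := by
  by_contra h
  have h1 : t - 1 ∈ IsLocalRing.maximalIdeal R :=
    Ideal.mem_of_dvd _ ((dvd_pow_self q two_ne_zero).trans ht) hq
  have h2 := Ideal.sub_mem _ ((IsLocalRing.mem_maximalIdeal t).2 h) h1
  rw [sub_sub_cancel] at h2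
  exact (Ideal.ne_top_iff_one _).1 (IsLocalRing.maximalIdeal.isMaximal R).ne_top h2

theorem ContainsTransvections.diagonal_mem [IsLocalRing R] {q : R}
    (hq : q ∈ IsLocalRing.maximalIdeal R) {T : Submonoid (Matrix n n R)}
    (hT : ContainsTransvections q T) (t : n → R) (ht : ∀ i, q ^ 2 ∣ t i - 1) (hdet : ∏ i, t i = 1) :
    Matrix.diagonal t ∈ T := by
  rcases isEmpty_or_nonempty n with hn | ⟨⟨i₀⟩⟩
  · rw [Subsingleton.elim (Matrix.diagonal t) 1]; exact T.one_mem
  have key : ∀ s : Finset n, i₀ ∉ s → ∀ t : n → R, (∀ i, q ^ 2 ∣ t i - 1) → ∏ i, t i = 1 →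
      (∀ i, i ≠ i₀ → i ∉ s → t i = 1) → Matrix.diagonal t ∈ T := by
    intro s
    induction s using Finset.induction_on with
    | empty =>
      intro _ t _ hdet h1
      rw [Fintype.prod_eq_single i₀ (fun i hi => h1 i hi (Finset.notMem_empty i))] at hdet
      have : t = 1 := by
        funext i
        by_cases hi : i = i₀
        · rw [hi, hdet, Pi.one_apply]
        · exact h1 i hi (Finset.notMem_empty i)
      rw [this, Matrix.diagonal_one']
      exact T.one_mem
    | insert a s ha ih =>
      intro hs t ht hdet h1
      rw [Finset.mem_insert, not_or] at hs
      obtain ⟨u, hu⟩ : IsUnit (t a) := isUnit_of_sq_dvd_sub_one hq (ht a)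
      have hdvd : q ^ 2 ∣ t i₀ * u - 1 := by
        have := dvd_add ((ht a).mul_left (t i₀)) (ht i₀)
        rwa [hu, show t i₀ * t a - 1 = t i₀ * (t a - 1) + (t i₀ - 1) by ring]
      have hdvd' : q ^ 2 ∣ (↑u⁻¹ : R) - 1 := by
        have := (ht a).mul_left (-(↑u⁻¹ : R))
        rwa [← hu, show -(↑u⁻¹ : R) * (u - 1) = (↑u⁻¹ : R) - (↑u⁻¹ : R) * u by ring,
          u.inv_mul] at this
      -- The entry at `a` is absorbed into the slot `i₀`, which keeps the product equal to one. Once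
      -- only `i₀` is left, the determinant forces its entry to be `1`.
      set t' := Function.update (Function.update t a 1) i₀ (t i₀ * u) with ht'
      have hmul : Matrix.diagonal t = Matrix.diagonal t' *
          Matrix.diagonal (Function.update (Function.update 1 i₀ (↑u⁻¹ : R)) a (↑(u⁻¹)⁻¹ : R)) := by
        rw [Matrix.diagonal_mul_diagonal]
        congr 1
        funext i
        by_cases hi : i = i₀
        · subst hi
          simp [ht', hs.1]
        · by_cases hia : i = a
          · subst hia
            simp [ht', hi, hu]
          · simp [ht', hi, hia]
      rw [hmul]
      refine T.mul_mem (ih hs.2 t' ?_ ?_ ?_) (hT.diagonal_pair_mem hs.1 u⁻¹ hdvd')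
      · intro i
        by_cases hi : i = i₀
        · subst hi
          simpa [ht'] using hdvd
        · by_cases hia : i = a
          · subst hia
            simp [ht', hi]
          · simpa [ht', hi, hia] using ht i
      · have hd := congrArg Matrix.det hmul
        rw [Matrix.det_mul, Matrix.det_diagonal, Matrix.det_diagonal, Matrix.det_diagonal, hdet,
          prod_update_update_one hs.1, u⁻¹.mul_inv, mul_one] at hd
        exact hd.symm
      · intro i hi his
        by_cases hia : i = a
        · subst hia
          simp [ht', hi]
        · simpa [ht', hi, hia] using h1 i hi (by simp [hia, his])
  exact key (Finset.univ.erase i₀) (Finset.notMem_erase _ _) t ht hdet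
    (fun i hi hi' => absurd (Finset.mem_erase.2 ⟨hi, Finset.mem_univ i⟩) hi')

/-- Gaussian elimination over a local ring: a matrix of determinant one congruent to the identity
modulo `q ^ 2` is a product of transvections with coefficients divisible by `q`. -/
theorem ContainsTransvections.mem_of_sq_dvd [IsLocalRing R] {q : R}
    (hq : q ∈ IsLocalRing.maximalIdeal R) {T : Submonoid (Matrix n n R)}
    (hT : ContainsTransvections q T) (M : Matrix n n R) (hM : ∀ i j, q ^ 2 ∣ M i j - (1 : Matrix n n R) i j)
    (hdet : M.det = 1) : M ∈ T := by
  have key : ∀ s : Finset n, ∀ M : Matrix n n R,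
      (∀ i j, q ^ 2 ∣ M i j - (1 : Matrix n n R) i j) → M.det = 1 →
      (∀ i j, j ∉ s → i ≠ j → M i j = 0) → M ∈ T := by
    intro s
    induction s using Finset.induction_on with
    | empty =>
      intro M hM hdet h0
      have hd : M = Matrix.diagonal fun i => M i i := by
        ext i j
        by_cases hij : i = j
        · subst hij; simp
        · rw [Matrix.diagonal_apply_ne _ hij, h0 i j (Finset.notMem_empty j) hij]
      rw [hd, Matrix.det_diagonal] at hdet
      rw [hd]
      exact hT.diagonal_mem hq _ (fun i => by simpa using hM i i) hdet
    | insert k s hk ih =>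
      intro M hM hdet h0
      obtain ⟨u, hu⟩ : IsUnit (M k k) := isUnit_of_sq_dvd_sub_one hq (by simpa using hM k k)
      -- Multipliers that clear column `k` using the unit pivot `M k k`. Since `v k = 0`, the matrix
      -- `E` below squares to zero, so `1 + E` and `1 - E` are inverse.
      set v : n → R := fun i => if i = k then 0 else M i k * ↑u⁻¹ with hv
      have hvk : v k = 0 := by simp [hv]
      have hvq : ∀ i, q ^ 2 ∣ v i := by
        intro i
        by_cases hi : i = k
        · simp [hv, hi]
        · have := hM i k
          rw [Matrix.one_apply_ne hi, sub_zero] at this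
          simpa [hv, hi] using this
      have hmem := hT.one_add_vecMulVec_mem k v hvk
        fun i => (dvd_pow_self q two_ne_zero).trans (hvq i)
      set E : Matrix n n R := vecMulVec v (Pi.single k 1) with hE
      have hEapp (N : Matrix n n R) (i j : n) : (E * N) i j = v i * N k j := by
        rw [hE, vecMulVec_mul]
        simp [vecMulVec_apply]
      have hEE : E * E = 0 := by
        ext i j
        rw [hEapp, hE, vecMulVec_apply, hvk, zero_mul, mul_zero, Matrix.zero_apply]
      have hdetE : (1 - E).det = 1 := by
        have : -E = replicateCol Unit (-v) * replicateRow Unit (Pi.single k (1 : R)) := by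
          rw [← Matrix.vecMulVec_eq, Matrix.neg_vecMulVec]
        rw [sub_eq_add_neg, this, Matrix.det_one_add_replicateCol_mul_replicateRow]
        simp [hvk]
      have hMeq : M = (1 + E) * ((1 - E) * M) := by
        rw [← mul_assoc, show (1 + E) * (1 - E) = 1 - E * E by noncomm_ring, hEE, sub_zero, one_mul]
      have happ (i j : n) : ((1 - E) * M) i j = M i j - v i * M k j := by
        rw [sub_mul, one_mul, Matrix.sub_apply, hEapp]
      rw [hMeq]
      refine T.mul_mem hmem (ih _ ?_ ?_ ?_)
      · intro i j
        rw [happ, sub_right_comm]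
        exact dvd_sub (hM i j) ((hvq i).mul_right _)
      · rw [Matrix.det_mul, hdetE, hdet, one_mul]
      · intro i j hj hij
        rw [happ]
        by_cases hjk : j = k
        · subst hjk
          simp [hv, hij, ← hu]
        -- Columns cleared earlier stay clear: the pivot row `k` already vanishes there.
        · rw [h0 i j (by simp [hjk, hj]) hij, h0 k j (by simp [hjk, hj]) (Ne.symm hjk)]
          simp
  exact key Finset.univ M hM hdet fun i j hj => absurd (Finset.mem_univ j) hj

end CongruenceElimination

/-! ### Congruence subgroups over `ℤ_p` and their commutators. -/

section Padic
variable {p : ℕ} [Fact p.Prime]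

theorem PadicInt.toZModPow_eq_iff_dvd_sub (k : ℕ) (x y : ℤ_[p]) :
    PadicInt.toZModPow k x = PadicInt.toZModPow k y ↔ (p : ℤ_[p]) ^ k ∣ x - y := by
  rw [← Ideal.mem_span_singleton, ← PadicInt.ker_toZModPow, RingHom.sub_mem_ker_iff]

theorem PadicInt.dist_le_iff_toZModPow_eq (k : ℕ) (x y : ℤ_[p]) :
    dist x y ≤ (p : ℝ) ^ (-k : ℤ) ↔ PadicInt.toZModPow k x = PadicInt.toZModPow k y := by
  rw [dist_eq_norm, PadicInt.norm_le_pow_iff_mem_span_pow, ← PadicInt.ker_toZModPow,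
    RingHom.sub_mem_ker_iff]

theorem PadicInt.isLocallyConstant_toZModPow (k : ℕ) :
    IsLocallyConstant (PadicInt.toZModPow k : ℤ_[p] → ZMod (p ^ k)) := by
  rw [IsLocallyConstant.iff_eventually_eq]
  intro x
  have hpos : (0 : ℝ) < (p : ℝ) ^ (-k : ℤ) := zpow_pos (by exact_mod_cast (Fact.out : p.Prime).pos) _
  filter_upwards [Metric.closedBall_mem_nhds x hpos] with y hy
  exact (PadicInt.dist_le_iff_toZModPow_eq k y x).1 hy

/-- The principal congruence subgroup of level `p ^ k` in `GL_d(ℤ_p)`. -/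
noncomputable def GLCongruenceSubgroup (p : ℕ) [Fact p.Prime] (d k : ℕ) : Subgroup (GL (Fin d) ℤ_[p]) :=
  (GeneralLinearGroup.map (PadicInt.toZModPow k)).ker

theorem mem_GLCongruenceSubgroup {d k : ℕ} {g : GL (Fin d) ℤ_[p]} :
    g ∈ GLCongruenceSubgroup p d k ↔
      ∀ i j, (p : ℤ_[p]) ^ k ∣ g i j - (1 : Matrix (Fin d) (Fin d) ℤ_[p]) i j := by
  simp_rw [← PadicInt.toZModPow_eq_iff_dvd_sub]
  rw [GLCongruenceSubgroup, MonoidHom.mem_ker, Matrix.GeneralLinearGroup.ext_iff]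
  refine forall₂_congr fun i j => ?_
  rw [GeneralLinearGroup.map_apply]
  simp [Matrix.one_apply, apply_ite (PadicInt.toZModPow k)]

theorem isOpen_GLCongruenceSubgroup (p : ℕ) [Fact p.Prime] (d k : ℕ) :
    IsOpen (GLCongruenceSubgroup p d k : Set (GL (Fin d) ℤ_[p])) := by
  have : (GLCongruenceSubgroup p d k : Set (GL (Fin d) ℤ_[p])) =
      ⋂ i, ⋂ j, {g | PadicInt.toZModPow k (g i j) =
        PadicInt.toZModPow k ((1 : Matrix (Fin d) (Fin d) ℤ_[p]) i j)} := by
    ext g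
    simp [mem_GLCongruenceSubgroup, PadicInt.toZModPow_eq_iff_dvd_sub]
  rw [this]
  refine isOpen_iInter_of_finite fun i => isOpen_iInter_of_finite fun j => ?_
  have hc : Continuous fun g : GL (Fin d) ℤ_[p] => g i j :=
    (Units.continuous_val).matrix_elem i j
  exact ((PadicInt.isLocallyConstant_toZModPow k).isOpen_fiber _).preimage hc

theorem GLCongruenceSubgroup_antitone {d k l : ℕ} (h : k ≤ l) :
    GLCongruenceSubgroup p d l ≤ GLCongruenceSubgroup p d k := fun _ hg =>
  mem_GLCongruenceSubgroup.2 fun i j => (pow_dvd_pow _ h).trans (mem_GLCongruenceSubgroup.1 hg i j)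

/-- The principal congruence subgroup of level `p ^ k` in `SL_d(ℤ_p)`. -/
noncomputable def SLCongruenceSubgroup (p : ℕ) [Fact p.Prime] (d k : ℕ) : Subgroup SL(d, ℤ_[p]) :=
  (GLCongruenceSubgroup p d k).comap Matrix.SpecialLinearGroup.toGL

theorem mem_SLCongruenceSubgroup {d k : ℕ} {g : SL(d, ℤ_[p])} :
    g ∈ SLCongruenceSubgroup p d k ↔
      ∀ i j, (p : ℤ_[p]) ^ k ∣ g i j - (1 : Matrix (Fin d) (Fin d) ℤ_[p]) i j :=
  mem_GLCongruenceSubgroup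

theorem isOpen_SLCongruenceSubgroup (p : ℕ) [Fact p.Prime] (d k : ℕ) :
    IsOpen (SLCongruenceSubgroup p d k : Set SL(d, ℤ_[p])) :=
  (isOpen_GLCongruenceSubgroup p d k).preimage Matrix.SpecialLinearGroup.continuous_toGL

theorem exists_SLCongruenceSubgroup_le {d : ℕ} {U : Subgroup SL(d, ℤ_[p])}
    (hU : IsOpen (U : Set SL(d, ℤ_[p]))) : ∃ k, SLCongruenceSubgroup p d k ≤ U := by
  obtain ⟨V, hV, hVU⟩ := isOpen_induced_iff.1 hU
  have h1 : (1 : Matrix (Fin d) (Fin d) ℤ_[p]) ∈ V := by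
    have : (1 : SL(d, ℤ_[p])) ∈ (Subtype.val ⁻¹' V : Set SL(d, ℤ_[p])) := by
      rw [hVU]; exact U.one_mem
    exact this
  obtain ⟨ε, hε, hball⟩ := Metric.isOpen_iff (α := Fin d → Fin d → ℤ_[p]).1 hV _ h1
  obtain ⟨k, hk⟩ := PadicInt.exists_pow_neg_lt p hε
  refine ⟨k, fun g hg => ?_⟩
  have : g ∈ (Subtype.val ⁻¹' V : Set SL(d, ℤ_[p])) := by
    refine hball (Metric.mem_ball.2 ((dist_pi_lt_iff hε).2 fun i => (dist_pi_lt_iff hε).2 fun j => ?_))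
    refine lt_of_le_of_lt ?_ hk
    rw [PadicInt.dist_le_iff_toZModPow_eq, PadicInt.toZModPow_eq_iff_dvd_sub]
    exact mem_SLCongruenceSubgroup.1 hg i j
  rw [hVU] at this
  exact this

/-- A subgroup containing the commutators of a congruence subgroup contains a deeper
congruence subgroup. -/
theorem SLCongruenceSubgroup_le_of_commutator_mem (hp : p ≠ 2) {d k : ℕ} (hk : 1 ≤ k)
    {H : Subgroup SL(d, ℤ_[p])}
    (hH : ∀ g ∈ SLCongruenceSubgroup p d k, ∀ h ∈ SLCongruenceSubgroup p d k, ⁅g, h⁆ ∈ H) :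
    SLCongruenceSubgroup p d (4 * k) ≤ H := by
  have hmax {x : ℤ_[p]} : (p : ℤ_[p]) ∣ x → x ∈ IsLocalRing.maximalIdeal ℤ_[p] := fun h => by
    rw [PadicInt.maximalIdeal_eq_span_p]; exact Ideal.mem_span_singleton.2 h
  have hpk : (p : ℤ_[p]) ∣ (p : ℤ_[p]) ^ k := dvd_pow_self _ (by omega)
  have hunit {x : ℤ_[p]} (h : ¬ (p : ℤ_[p]) ∣ x) : IsUnit x := by
    by_contra hx
    exact h ((PadicInt.norm_lt_one_iff_dvd x).1 (PadicInt.not_isUnit_iff.1 hx))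
  obtain ⟨u, hu⟩ : IsUnit (1 + (p : ℤ_[p]) ^ k) := hunit fun h =>
    PadicInt.prime_p.not_dvd_one ((dvd_add_left hpk).1 h)
  -- With `u = 1 + p ^ k`, one has `u ^ 2 - 1 = p ^ k * w`; `w` is a unit because `p` is odd.
  obtain ⟨w, hw⟩ : IsUnit (2 + (p : ℤ_[p]) ^ k) := hunit fun h => by
    have h2 := (dvd_add_left hpk).1 h
    have : (p : ℤ_[p]) ^ 1 ∣ ((2 : ℤ) : ℤ_[p]) := by simpa using h2
    rw [PadicInt.pow_p_dvd_int_iff, pow_one] at this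
    exact hp ((Nat.prime_dvd_prime_iff_eq Fact.out Nat.prime_two).1 (by exact_mod_cast this))
  set T : Submonoid (Matrix (Fin d) (Fin d) ℤ_[p]) :=
    H.toSubmonoid.map Matrix.SpecialLinearGroup.coeMonoidHom
  have hT : ContainsTransvections ((p : ℤ_[p]) ^ (2 * k)) T := by
    intro i j hij x
    -- Chosen so that `(u ^ 2 - 1) * y = p ^ (2 * k) * x`.
    set y : ℤ_[p] := (p : ℤ_[p]) ^ k * (x * ↑w⁻¹) with hy
    let f : Fin d → ℤ_[p] := Function.update (Function.update 1 i (u : ℤ_[p])) j (↑u⁻¹ : ℤ_[p])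
    have hf : (Matrix.diagonal f).det = 1 := by
      rw [Matrix.det_diagonal, prod_update_update_one hij, u.mul_inv]
    let t : SL(d, ℤ_[p]) := ⟨Matrix.diagonal f, hf⟩
    let e (z : ℤ_[p]) : SL(d, ℤ_[p]) := Matrix.SpecialLinearGroup.transvection hij z
    have ht : t ∈ SLCongruenceSubgroup p d k := by
      rw [mem_SLCongruenceSubgroup]
      intro a b
      change _ ∣ Matrix.diagonal f a b - _
      by_cases hab : a = b
      · subst hab
        rw [Matrix.diagonal_apply_eq, Matrix.one_apply_eq]
        by_cases haj : a = j
        · subst haj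
          simp only [f, Function.update_self]
          refine ⟨-↑u⁻¹, ?_⟩
          linear_combination (-(↑u⁻¹ : ℤ_[p])) * hu + u.mul_inv
        · by_cases hai : a = i
          · subst hai
            simp [f, haj, hu]
          · simp [f, hai, haj]
      · rw [Matrix.diagonal_apply_ne _ hab, Matrix.one_apply_ne hab, sub_zero]
        exact dvd_zero _
    have he : e y ∈ SLCongruenceSubgroup p d k := by
      rw [mem_SLCongruenceSubgroup]
      intro a b
      change _ ∣ Matrix.transvection i j y a b - _
      rw [Matrix.transvection, Matrix.add_apply, add_sub_cancel_left, Matrix.single_apply]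
      split_ifs
      · exact dvd_mul_right _ _
      · exact dvd_zero _
    -- Conjugation by `t` scales the `(i, j)` entry by `u / u⁻¹ = u ^ 2`.
    have hcomm : t * e y = e (u ^ 2 * y) * t := by
      apply Subtype.ext
      change Matrix.diagonal f * Matrix.transvection i j y =
        Matrix.transvection i j (u ^ 2 * y) * Matrix.diagonal f
      rw [Matrix.transvection, Matrix.transvection, mul_add, add_mul, mul_one, one_mul]
      congr 1
      ext a b
      rw [Matrix.diagonal_mul, Matrix.mul_diagonal, Matrix.single_apply, Matrix.single_apply]
      split_ifs with h
      · obtain ⟨rfl, rfl⟩ := h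
        simp only [f, Function.update_self, Function.update_of_ne hij]
        linear_combination (-(u : ℤ_[p]) * y) * u.mul_inv
      · simp
    have hadd (a b : ℤ_[p]) : e a * e b = e (a + b) := by
      apply Subtype.ext
      exact Matrix.transvection_mul_transvection_same i j hij a b
    have hcomm' : ⁅t, e y⁆ = e ((p : ℤ_[p]) ^ (2 * k) * x) := by
      rw [commutatorElement_def, hcomm, mul_inv_cancel_right, mul_inv_eq_iff_eq_mul, hadd]
      congr 1
      rw [hu, hy]
      linear_combination (-(p : ℤ_[p]) ^ (2 * k) * x * ↑w⁻¹) * hw +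
        (p : ℤ_[p]) ^ (2 * k) * x * w.mul_inv
    exact ⟨e _, hcomm' ▸ hH t ht _ he, rfl⟩
  intro g hg
  obtain ⟨h, hh, hhg⟩ := hT.mem_of_sq_dvd (hmax (dvd_pow_self _ (by omega))) g.1
    (by rw [← pow_mul, show 2 * k * 2 = 4 * k by ring]; exact mem_SLCongruenceSubgroup.1 hg) g.2
  have : h = g := Subtype.ext hhg
  exact this ▸ hh

end Padic

/-! ### Closed subgroups of `ℤ_p^×`. -/

section Units
variable {p : ℕ} [Fact p.Prime]

/-- Each `p`-th power raises the valuation of the difference from `1` by exactly one: the linear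
binomial term dominates, since `2 ≤ v` makes the remainder divisible by `p ^ (v + k + 2)`. -/
theorem PadicInt.pow_p_pow_sub_one {v : ℕ} (hv : 2 ≤ v) (u : ℤ_[p]ˣ) (k : ℕ) :
    ∃ w : ℤ_[p]ˣ, (1 + (p : ℤ_[p]) ^ v * u) ^ p ^ k = 1 + (p : ℤ_[p]) ^ (v + k) * w := by
  induction k with
  | zero => exact ⟨u, by simp⟩
  | succ k ih =>
    obtain ⟨w, hw⟩ := ih
    obtain ⟨c, hc⟩ := sq_dvd_add_pow_sub_sub ((p : ℤ_[p]) ^ (v + k) * w) 1 p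
    have hunit : IsUnit ((w : ℤ_[p]) + p * (p ^ (v + k - 2) * w ^ 2 * c)) := by
      by_contra h
      rw [PadicInt.not_isUnit_iff, PadicInt.norm_lt_one_iff_dvd, dvd_add_left (dvd_mul_right _ _),
        ← PadicInt.norm_lt_one_iff_dvd, ← PadicInt.not_isUnit_iff] at h
      exact h w.isUnit
    refine ⟨hunit.unit, ?_⟩
    rw [pow_succ, pow_mul, hw, IsUnit.unit_spec]
    obtain ⟨m, hm⟩ : ∃ m, v + k = m + 2 := ⟨v + k - 2, by omega⟩
    rw [hm] at hc
    rw [show v + (k + 1) = m + 3 by omega, hm, Nat.add_sub_cancel]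
    simp only [one_pow, one_mul] at hc
    linear_combination hc

/-- A closed subgroup of `ℤ_p^×` with a nontrivial element congruent to `1` modulo `p ^ 2` contains
a neighbourhood of `1`. -/
theorem PadicInt.exists_units_mem_of_dvd_sub_one {A : Subgroup ℤ_[p]ˣ}
    (hA : IsClosed (A : Set ℤ_[p]ˣ)) {a : ℤ_[p]ˣ} (ha : a ∈ A) (ha1 : a ≠ 1)
    (hdvd : (p : ℤ_[p]) ^ 2 ∣ a - 1) :
    ∃ v : ℕ, ∀ y : ℤ_[p]ˣ, (p : ℤ_[p]) ^ v ∣ y - 1 → y ∈ A := by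
  have hne : (a : ℤ_[p]) - 1 ≠ 0 := fun h => ha1 (Units.ext (sub_eq_zero.1 h))
  set v := ((a : ℤ_[p]) - 1).valuation
  set u := PadicInt.unitCoeff hne
  have hau : (a : ℤ_[p]) = 1 + (p : ℤ_[p]) ^ v * u := by
    linear_combination PadicInt.unitCoeff_spec hne
  have hv : 2 ≤ v := by
    rw [← Ideal.mem_span_singleton, PadicInt.mem_span_pow_iff_le_valuation _ hne] at hdvd
    exact hdvd
  refine ⟨v, fun y hy => ?_⟩
  have happrox : ∀ k : ℕ, ∃ b ∈ A, (p : ℤ_[p]) ^ (v + k) ∣ y - b := by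
    intro k
    induction k with
    | zero => exact ⟨1, A.one_mem, by simpa using hy⟩
    | succ k ih =>
      obtain ⟨b, hb, z, hz⟩ := ih
      obtain ⟨w, hw⟩ := PadicInt.pow_p_pow_sub_one hv u k
      -- Modulo higher order, `(a ^ p ^ k) ^ n` is `1 + n * p ^ (v + k) * w`. Taking `n ≡ t` modulo
      -- `p` cancels the leading term of `y - b`, so powers of `a` approximate `y` to any precision.
      set t : ℤ_[p] := z * ↑b⁻¹ * ↑w⁻¹ with ht
      obtain ⟨n, hn⟩ : ∃ n : ℕ, (p : ℤ_[p]) ∣ t - n := by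
        obtain ⟨n, -, hn⟩ := PadicInt.exists_mem_range (x := t)
        refine ⟨n, ?_⟩
        rwa [PadicInt.maximalIdeal_eq_span_p, Ideal.mem_span_singleton] at hn
      obtain ⟨r, hr⟩ := hn
      refine ⟨b * (a ^ p ^ k) ^ n, A.mul_mem hb (A.pow_mem (A.pow_mem ha _) _), ?_⟩
      obtain ⟨c, hc⟩ := sq_dvd_add_pow_sub_sub ((p : ℤ_[p]) ^ (v + k) * w) 1 n
      push_cast
      rw [hau, hw]
      obtain ⟨m, hm⟩ : ∃ m, v + k = m + 1 := ⟨v + k - 1, by omega⟩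
      rw [hm] at hc hz
      rw [show v + (k + 1) = m + 2 by omega, hm]
      simp only [one_pow, one_mul] at hc
      have hz' : z = t * w * b := by
        rw [ht]
        linear_combination -z * b.inv_mul - z * (↑b⁻¹ * b : ℤ_[p]) * w.inv_mul
      refine ⟨b * w * r - b * w ^ 2 * p ^ m * c, ?_⟩
      linear_combination hz + (p : ℤ_[p]) ^ (m + 1) * hz' + (p : ℤ_[p]) ^ (m + 1) * w * b * hr -
        (b : ℤ_[p]) * hc
  rw [← SetLike.mem_coe, ← hA.closure_eq]
  have hemb : Topology.IsEmbedding (Units.val : ℤ_[p]ˣ → ℤ_[p]) :=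
    Units.isOpenEmbedding_val.isEmbedding
  rw [hemb.closure_eq_preimage_closure_image, Set.mem_preimage, Metric.mem_closure_iff]
  intro ε hε
  obtain ⟨k, hk⟩ := PadicInt.exists_pow_neg_lt p hε
  obtain ⟨b, hb, hdb⟩ := happrox k
  refine ⟨b, ⟨b, hb, rfl⟩, lt_of_le_of_lt ?_ hk⟩
  rw [PadicInt.dist_le_iff_toZModPow_eq, PadicInt.toZModPow_eq_iff_dvd_sub]
  exact (pow_dvd_pow _ (Nat.le_add_left k v)).trans hdb

end Units

/-! ### Openness criteria in `GL_d(ℤ_p)`. -/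

section OpenSubgroups
variable {p : ℕ} [Fact p.Prime] {d : ℕ}

theorem ContainsOpenSubgroupOfSL.of_commutator_mem (hp : p ≠ 2) {G H : Subgroup (GL (Fin d) ℤ_[p])}
    (hG : ContainsOpenSubgroupOfSL p d G) (hGH : ∀ g ∈ G, ∀ h ∈ G, ⁅g, h⁆ ∈ H) :
    ContainsOpenSubgroupOfSL p d H := by
  obtain ⟨U, hU, hUG⟩ := hG
  obtain ⟨k, hk⟩ := exists_SLCongruenceSubgroup_le hU
  -- The level is raised to `k + 1` because the commutator lemma needs it positive.
  have hk' : SLCongruenceSubgroup p d (k + 1) ≤ U :=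
    (Subgroup.comap_mono (GLCongruenceSubgroup_antitone k.le_succ)).trans hk
  have hmem {g} (hg : g ∈ SLCongruenceSubgroup p d (k + 1)) :
      Matrix.SpecialLinearGroup.toGL g ∈ G := hUG (Subgroup.mem_map_of_mem _ (hk' hg))
  refine ⟨SLCongruenceSubgroup p d (4 * (k + 1)), isOpen_SLCongruenceSubgroup p d _, ?_⟩
  rw [Subgroup.map_le_iff_le_comap]
  refine SLCongruenceSubgroup_le_of_commutator_mem hp (by omega) fun g hg h hh => ?_
  rw [Subgroup.mem_comap, map_commutatorElement]
  exact hGH _ (hmem hg) _ (hmem hh)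

theorem continuous_GL_det : Continuous (Matrix.GeneralLinearGroup.det : GL (Fin d) ℤ_[p] → ℤ_[p]ˣ) := by
  rw [Units.isOpenEmbedding_val.isEmbedding.continuous_iff]
  exact (Units.continuous_val).matrix_det

theorem dvd_det_sub_one_of_mem {k : ℕ} {g : GL (Fin d) ℤ_[p]}
    (hg : g ∈ GLCongruenceSubgroup p d k) :
    (p : ℤ_[p]) ^ k ∣ Matrix.GeneralLinearGroup.det g - 1 := by
  rw [← PadicInt.toZModPow_eq_iff_dvd_sub, map_one]
  have h := congrArg (fun g => ((Matrix.GeneralLinearGroup.det g : (ZMod (p ^ k))ˣ) : ZMod (p ^ k)))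
    (MonoidHom.mem_ker.1 hg)
  simpa [Matrix.GeneralLinearGroup.map_det] using h

/-- A compact subgroup of `GL_d(ℤ_p)` that contains an open subgroup of `SL_d(ℤ_p)` and has infinite
image under the determinant is open. -/
theorem ContainsOpenSubgroupOfSL.isOpen_of_infinite_det {H : Subgroup (GL (Fin d) ℤ_[p])}
    (hH : ContainsOpenSubgroupOfSL p d H) (hc : IsCompact (H : Set (GL (Fin d) ℤ_[p])))
    (hinf : (Matrix.GeneralLinearGroup.det '' (H : Set (GL (Fin d) ℤ_[p]))).Infinite) :
    IsOpen (H : Set (GL (Fin d) ℤ_[p])) := by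
  obtain ⟨U, hU, hUH⟩ := hH
  obtain ⟨k, hk⟩ := exists_SLCongruenceSubgroup_le hU
  -- Level `k` places determinant-one elements of `Γ` in `U`; level `2` is what
  -- `PadicInt.exists_units_mem_of_dvd_sub_one` requires.
  set m := max k 2
  set Γ := GLCongruenceSubgroup p d m
  have hΓc : IsClosed (Γ : Set (GL (Fin d) ℤ_[p])) :=
    Subgroup.isClosed_of_isOpen _ (isOpen_GLCongruenceSubgroup p d m)
  have hA : IsClosed (((H ⊓ Γ).map Matrix.GeneralLinearGroup.det : Subgroup ℤ_[p]ˣ) : Set ℤ_[p]ˣ) := by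
    rw [Subgroup.coe_map, Subgroup.coe_inf]
    exact ((hc.inter_right hΓc).image continuous_GL_det).isClosed
  obtain ⟨a, haA, ha1⟩ : ∃ a ∈ (H ⊓ Γ).map Matrix.GeneralLinearGroup.det, a ≠ 1 := by
    have := hinf.to_subtype
    choose h hhH hh using fun s : Matrix.GeneralLinearGroup.det '' (H : Set (GL (Fin d) ℤ_[p])) => s.2
    have : NeZero (p ^ m) := ⟨pow_ne_zero _ (Fact.out : p.Prime).ne_zero⟩
    -- Pigeonhole: `GL_d(ℤ/p^m)` is finite, so two elements of `H` with different determinants agree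
    -- modulo `p ^ m`, and their quotient lies in `Γ`.
    obtain ⟨s, t, hst, heq⟩ := Finite.exists_ne_map_eq_of_infinite
      fun s => Matrix.GeneralLinearGroup.map (n := Fin d) (PadicInt.toZModPow (p := p) m) (h s)
    refine ⟨_, ⟨h s * (h t)⁻¹, ⟨H.mul_mem (hhH s) (H.inv_mem (hhH t)), ?_⟩, rfl⟩, ?_⟩
    · change _ ∈ MonoidHom.ker _
      rw [MonoidHom.mem_ker, map_mul, map_inv, heq, mul_inv_cancel]
    · rw [map_mul, map_inv, hh, hh, Ne, mul_inv_eq_one]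
      exact fun h => hst (Subtype.ext h)
  have hdvd : (p : ℤ_[p]) ^ 2 ∣ a - 1 := by
    obtain ⟨g, hg, rfl⟩ := haA
    exact (pow_dvd_pow _ (le_max_right k 2)).trans (dvd_det_sub_one_of_mem hg.2)
  obtain ⟨v, hv⟩ := PadicInt.exists_units_mem_of_dvd_sub_one hA haA ha1 hdvd
  refine Subgroup.isOpen_mono (H₁ := GLCongruenceSubgroup p d (max m v)) ?_
    (isOpen_GLCongruenceSubgroup p d _)
  intro g hg
  -- Dividing `g` by an element of `H ⊓ Γ` with the same determinant leaves a determinant-one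
  -- element of `Γ`, which `U` contains.
  obtain ⟨h, ⟨hhH, hhΓ⟩, hdet⟩ := hv (Matrix.GeneralLinearGroup.det g)
    ((pow_dvd_pow _ (le_max_right m v)).trans (dvd_det_sub_one_of_mem hg))
  have hmem : h⁻¹ * g ∈ Γ :=
    Γ.mul_mem (Γ.inv_mem hhΓ) (GLCongruenceSubgroup_antitone (le_max_left m v) hg)
  have hdet1 : ((h⁻¹ * g : GL (Fin d) ℤ_[p]) : Matrix (Fin d) (Fin d) ℤ_[p]).det = 1 := by
    rw [← Matrix.GeneralLinearGroup.val_det_apply, map_mul, map_inv, hdet, inv_mul_cancel,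
      Units.val_one]
  set s : SL(d, ℤ_[p]) := ⟨_, hdet1⟩
  have hs : Matrix.SpecialLinearGroup.toGL s = h⁻¹ * g := Units.ext rfl
  have hsU : s ∈ U := hk (by
    rw [SLCongruenceSubgroup, Subgroup.mem_comap, hs]
    exact GLCongruenceSubgroup_antitone (le_max_left k 2) hmem)
  have := H.mul_mem hhH (hUH (Subgroup.mem_map_of_mem _ hsU))
  rwa [hs, mul_inv_cancel_left] at this

end OpenSubgroups

/-! ### Commuting automorphisms of the residue field. -/

section ResidueField

/-- Ring automorphisms of a field all of whose nonzero elements are roots of unity commute. -/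
theorem RingAut.commute_of_isOfFinOrder {k : Type*} [Field k]
    (hk : ∀ x : k, x ≠ 0 → IsOfFinOrder x) (σ τ : RingAut k) : Commute σ τ := by
  refine RingEquiv.ext fun x => ?_
  change σ (τ x) = τ (σ x)
  by_cases hx : x = 0
  · simp [hx]
  have hprim := IsPrimitiveRoot.orderOf x
  have : NeZero (orderOf x) := ⟨(hk x hx).orderOf_pos.ne'⟩
  -- The image of `x` is a root of unity of order dividing that of `x`, hence a power of `x`; power
  -- maps commute.
  have h (φ : RingAut k) : ∃ i : ℕ, x ^ i = φ x := by
    obtain ⟨i, -, hi⟩ := hprim.eq_pow_of_pow_eq_one (ξ := φ x)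
      (by rw [← map_pow, pow_orderOf_eq_one, map_one])
    exact ⟨i, hi⟩
  obtain ⟨i, hi⟩ := h σ
  obtain ⟨j, hj⟩ := h τ
  rw [← hi, ← hj, map_pow, map_pow, ← hi, ← hj, ← pow_mul, ← pow_mul, mul_comm]

theorem isOfFinOrder_of_isAlgebraic_zmod (p : ℕ) [Fact p.Prime] {k : Type*} [Field k]
    [Algebra (ZMod p) k] {x : k} (hx : IsAlgebraic (ZMod p) x) (hx0 : x ≠ 0) : IsOfFinOrder x := by
  have : FiniteDimensional (ZMod p) (IntermediateField.adjoin (ZMod p) {x}) :=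
    IntermediateField.adjoin.finiteDimensional hx.isIntegral
  have : Finite (IntermediateField.adjoin (ZMod p) {x}) := Module.finite_of_finite (ZMod p)
  have hgen : IntermediateField.AdjoinSimple.gen (ZMod p) x ≠ 0 := fun h =>
    hx0 (by rw [← IntermediateField.AdjoinSimple.coe_gen (ZMod p) x, h]; rfl)
  exact MonoidHom.isOfFinOrder
    ((algebraMap (IntermediateField.adjoin (ZMod p) {x}) k : _ →* k).comp (Units.coeHom _))
    (isOfFinOrder_of_finite (Units.mk0 _ hgen))

/-- In a valuation ring of an algebraic extension of `ℚ` with `p` in the maximal ideal, the nonzero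
elements of the residue field are roots of unity. -/
theorem ValuationSubring.isOfFinOrder_residueField (p : ℕ) [Fact p.Prime] {L : Type*} [Field L]
    [CharZero L] [Algebra.IsAlgebraic ℤ L] (A : ValuationSubring L)
    (hp : (p : A) ∈ IsLocalRing.maximalIdeal A) (x : IsLocalRing.ResidueField A) (hx : x ≠ 0) :
    IsOfFinOrder x := by
  have hp0 : (p : IsLocalRing.ResidueField A) = 0 := by
    rw [← map_natCast (IsLocalRing.residue A)]
    exact (IsLocalRing.residue_eq_zero_iff _).2 hp
  have : CharP (IsLocalRing.ResidueField A) p :=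
    (CharP.charP_iff_prime_eq_zero Fact.out).2 hp0
  let _ : Algebra (ZMod p) (IsLocalRing.ResidueField A) := ZMod.algebra _ p
  refine isOfFinOrder_of_isAlgebraic_zmod p ?_ hx
  obtain ⟨y, rfl⟩ := IsLocalRing.residue_surjective x
  obtain ⟨f, hf0, hf⟩ := Algebra.IsAlgebraic.isAlgebraic (R := ℤ) (y : L)
  -- A primitive integer polynomial stays nonzero modulo `p`, so its reduction is an algebraic
  -- relation for the residue class over `𝔽_p`.
  have hg := Polynomial.aeval_primPart_eq_zero hf0 hf
  have hgy : Polynomial.aeval y f.primPart = 0 := by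
    apply FaithfulSMul.algebraMap_injective A L
    rw [map_zero, ← Polynomial.aeval_algebraMap_apply]
    exact hg
  refine ⟨f.primPart.map (Int.castRingHom (ZMod p)), ?_, ?_⟩
  · intro h0
    have hC : Polynomial.C (p : ℤ) ∣ f.primPart := by
      rw [Polynomial.C_dvd_iff_dvd_coeff]
      intro i
      have := congrArg (fun g => Polynomial.coeff g i) h0
      rw [← ZMod.intCast_zmod_eq_zero_iff_dvd]
      simpa using this
    have := (f.isPrimitive_primPart) p hC
    exact (Nat.prime_iff_prime_int.1 (Fact.out : p.Prime)).not_isUnit this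
  · have := congrArg (IsLocalRing.residue A) hgy
    rw [map_zero, Polynomial.aeval_def, Polynomial.hom_eval₂] at this
    rw [Polynomial.aeval_def, Polynomial.eval₂_map]
    convert! this using 2
    exact Subsingleton.elim _ _

end ResidueField

/-! ### Topology of decomposition and inertia groups, and their abelian quotient. -/

section Decomposition

open scoped Pointwise
variable (K : Type*) [Field K] {L : Type*} [Field L] [Algebra K L]

/-- Stabilizers of elements are open in the Krull topology. Any condition on the single value `σ x`
is therefore clopen, and the decomposition and inertia groups are intersections of such conditions.
-/
theorem isLocallyConstant_algEquiv_apply [Algebra.IsIntegral K L] (x : L) :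
    IsLocallyConstant fun σ : L ≃ₐ[K] L => σ x := by
  rw [IsLocallyConstant.iff_eventually_eq]
  intro σ
  have h := (stabilizer_isOpen_of_isIntegral (K := K) x).mem_nhds (one_mem (MulAction.stabilizer _ x))
  have := (continuous_const_mul σ⁻¹).continuousAt (x := σ) |>.preimage_mem_nhds (by rwa [inv_mul_cancel])
  filter_upwards [this] with τ hτ
  have : σ⁻¹ (τ x) = x := hτ
  exact (AlgEquiv.symm_apply_eq σ).1 this

theorem ValuationSubring.isClosed_decompositionSubgroup [Algebra.IsIntegral K L]
    (A : ValuationSubring L) : IsClosed (A.decompositionSubgroup K : Set (L ≃ₐ[K] L)) := by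
  have : (A.decompositionSubgroup K : Set (L ≃ₐ[K] L)) = ⋂ x : L, {σ | σ x ∈ A ↔ x ∈ A} := by
    ext σ
    simp only [SetLike.mem_coe, MulAction.mem_stabilizer_iff, Set.mem_iInter, Set.mem_ofPred_eq]
    constructor
    · intro h x
      have := ValuationSubring.smul_mem_pointwise_smul_iff (g := σ) (S := A) (x := x)
      rwa [h] at this
    · intro h
      ext x
      rw [ValuationSubring.mem_pointwise_smul_iff_inv_smul_mem, ← h, AlgEquiv.smul_def]
      rw [show σ (σ⁻¹ x) = x from σ.apply_symm_apply x]
  rw [this]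
  refine isClosed_iInter fun x => ?_
  exact isOpen_compl_iff.1 (isLocallyConstant_algEquiv_apply K x {y | y ∈ A ↔ x ∈ A}ᶜ)

theorem ValuationSubring.isClosed_inertiaSubgroup [Algebra.IsIntegral K L]
    (A : ValuationSubring L) : IsClosed (A.inertiaSubgroup K : Set (A.decompositionSubgroup K)) := by
  have : (A.inertiaSubgroup K : Set (A.decompositionSubgroup K)) = ⋂ a : A,
      {σ : A.decompositionSubgroup K | (σ : L ≃ₐ[K] L) a ∈
      {y : L | ∃ h : y ∈ A, IsLocalRing.residue A ⟨y, h⟩ = IsLocalRing.residue A a}} := by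
    ext σ
    simp only [SetLike.mem_coe, ValuationSubring.inertiaSubgroup, MonoidHom.mem_ker, Set.mem_iInter,
      Set.mem_ofPred_eq]
    constructor
    · intro h a
      refine ⟨(σ • a).2, ?_⟩
      change IsLocalRing.residue A (σ • a) = _
      rw [IsLocalRing.ResidueField.residue_smul]
      exact congrArg (fun φ : RingAut _ => φ (IsLocalRing.residue A a)) h
    · intro h
      refine RingEquiv.ext fun x => ?_
      obtain ⟨a, rfl⟩ := IsLocalRing.residue_surjective x
      change σ • IsLocalRing.residue A a = _
      obtain ⟨_, ha⟩ := h a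
      rw [← IsLocalRing.ResidueField.residue_smul]
      exact ha
  rw [this]
  refine isClosed_iInter fun a => ?_
  have := isOpen_compl_iff.1 (isLocallyConstant_algEquiv_apply K (a : L)
    {y : L | ∃ h : y ∈ A, IsLocalRing.residue A ⟨y, h⟩ = IsLocalRing.residue A a}ᶜ)
  exact this.preimage continuous_subtype_val

/-- Inertia is the kernel of the action on the residue field, whose automorphisms commute. -/
theorem ValuationSubring.commutator_mem_inertiaSubgroup (p : ℕ) [Fact p.Prime] 
    [CharZero L] [Algebra.IsAlgebraic ℤ L] (A : ValuationSubring L)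
    (hp : (p : A) ∈ IsLocalRing.maximalIdeal A) (σ τ : A.decompositionSubgroup K) :
    ⁅σ, τ⁆ ∈ A.inertiaSubgroup K := by
  rw [ValuationSubring.inertiaSubgroup, MonoidHom.mem_ker, map_commutatorElement,
    commutatorElement_eq_one_iff_commute]
  exact RingAut.commute_of_isOfFinOrder (A.isOfFinOrder_residueField p hp) _ _

end Decomposition

/-! ### The place attached to `ι` and the main theorem. -/

theorem natCast_mem_maximalIdeal_embeddingValuationRing (p : ℕ) [Fact p.Prime] {Kbar : Type*}
    [Field Kbar] (ι : Kbar →+* PadicAlgCl p) :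
    (p : embeddingValuationRing p ι) ∈ IsLocalRing.maximalIdeal (embeddingValuationRing p ι) := by
  rw [IsLocalRing.mem_maximalIdeal, mem_nonunits_iff]
  intro h
  obtain ⟨y, hy⟩ := h.exists_right_inv
  have hy1 : (Valued.v (ι (y : Kbar)) : ℝ≥0) ≤ 1 := y.2
  have h1 := congrArg (fun z : embeddingValuationRing p ι => (Valued.v (ι (z : Kbar)) : ℝ≥0)) hy
  have hlt : (Valued.v (p : PadicAlgCl p) : ℝ≥0) < 1 := by
    rw [PadicAlgCl.valuation_p]
    simpa using inv_lt_one_of_one_lt₀ (by exact_mod_cast (Fact.out : p.Prime).one_lt : (1 : ℝ≥0) < p)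
  simp only [MulMemClass.coe_mul, map_mul, OneMemClass.coe_one, map_one] at h1
  rw [show ((p : embeddingValuationRing p ι) : Kbar) = p from rfl, map_natCast] at h1
  exact (mul_lt_one_of_lt_of_le hlt hy1).ne h1

theorem mainTheorem9 (p : ℕ) [Fact p.Prime] (hp : p ≠ 2)
    (K : Type*) [Field K] [NumberField K]
    (Kbar : Type*) [Field Kbar] [Algebra K Kbar] [IsAlgClosure K Kbar]
    (ι : Kbar →+* PadicAlgCl p)
    (d : ℕ) (hd : 1 ≤ d)
    (ρ : decompositionGroup p K ι →* GL (Fin d) ℤ_[p]) (hρ : Continuous ρ)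
    (hSL : ContainsOpenSubgroupOfSL p d ρ.range) :
    ContainsOpenSubgroupOfSL p d ((inertiaGroup p K ι).map ρ) ∧
    ((Matrix.GeneralLinearGroup.det '' ((inertiaGroup p K ι).map ρ : Set (GL (Fin d) ℤ_[p]))).Infinite →
      IsOpen ((inertiaGroup p K ι).map ρ : Set (GL (Fin d) ℤ_[p]))) := by
  have : CharZero Kbar := charZero_of_injective_algebraMap (algebraMap K Kbar).injective
  have : Algebra.IsAlgebraic K Kbar := IsAlgClosure.isAlgebraic
  have : IsGalois K Kbar := IsAlgClosure.isGalois K Kbar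
  have : Algebra.IsAlgebraic ℚ Kbar := Algebra.IsAlgebraic.trans ℚ K Kbar
  have : Algebra.IsAlgebraic ℤ Kbar := (IsFractionRing.comap_isAlgebraic_iff (A := ℤ) (K := ℚ)).2 ‹_›
  have hI : ContainsOpenSubgroupOfSL p d ((inertiaGroup p K ι).map ρ) := by
    refine hSL.of_commutator_mem hp ?_
    rintro _ ⟨σ, rfl⟩ _ ⟨τ, rfl⟩
    rw [← map_commutatorElement]
    exact Subgroup.mem_map_of_mem _ (ValuationSubring.commutator_mem_inertiaSubgroup K p _
      (natCast_mem_maximalIdeal_embeddingValuationRing p ι) σ τ)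
  refine ⟨hI, hI.isOpen_of_infinite_det ?_⟩
  -- Inertia is closed in a closed subgroup of the compact Galois group, so its image under `ρ` is
  -- compact.
  have : CompactSpace (decompositionGroup p K ι) := isCompact_iff_compactSpace.1
    (ValuationSubring.isClosed_decompositionSubgroup K (embeddingValuationRing p ι)).isCompact
  rw [Subgroup.coe_map]
  exact (ValuationSubring.isClosed_inertiaSubgroup K _).isCompact.image hρ
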